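/- Let $n,m,s\ge 0$ be integers with $s\le m$. Let $e_1,\dots,e_n$ be the canonical basis of $\mathbb R^n$ and, for $\tau\subseteq[n]=\{1,\dots,n\}$, let $H_\tau$ be the linear span of $\{e_i:i\in\tau\}$ and $H_\tau^\perp$ its orthogonal complement. For $k\ge 0$, a finite family $(\tau_i)_{i\in I}$ of subsets of $[n]$ is called a $k$-cover of $\sigma\subseteq[n]$ if $\tau_i\subseteq\sigma$ for every $i\in I$ and every element of $\sigma$ belongs to $\tau_i$ for exactly $k$ indices $i\in I$. A $k$-cover $(\tau_i)_{i\in I}$ of $\sigma$ is called $1$-reducible if $I$ can be partitioned into $k$ (possibly empty) blocks $I_1,\dots,I_k$ such that $(\tau_i)_{i\in I_l}$ is a $1$-cover of $\sigma$ for every $l=1,\dots,k$. Let $f:\mathbb R^n\to[0,\infty)$ be Lebesgue integrable and log-concave, i.e. $f((1-t)x+ty)\ge f(x)^{1-t}f(y)^{t}$ for all $x,y\in\mathbb R^n$ and $t\in[0,1]$. Let $\sigma\subseteq[n]$ and let $\sigma_1,\dots,\sigma_m\subseteq\sigma$ be such that $(\sigma\setminus\sigma_1,\dots,\sigma\setminus\sigma_m)$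 is a $1$-reducible $(m-s)$-cover of $\sigma$. Then $$\left(\sup_{x\in\mathbb R^n}\int_{x+H_\sigma^\perp}f(y)\,dy\right)^{s}\left(\int_{\mathbb R^n}f(x)\,dx\right)^{m-s}\ \ge\ \frac{\prod_{j=1}^m(|\sigma|-|\sigma_j|)!}{(|\sigma|!)^{m-s}}\ \prod_{j=1}^m\int_{H_{\sigma_j}^\perp}f(x)\,dx .$$ Here the integral over an affine subspace is taken with respect to its own Lebesgue measure (the Dirac measure if it is a single point), and all quantities are understood in $[0,\infty]$ with the conventions $0\cdot\infty=0$ and $a^0=1$. -/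

import Mathlib

open MeasureTheory
open scoped ENNReal Nat

/-- The class of integrable log-concave functions `ℝⁿ → [0, ∞)`. A function that is only defined
on a convex set is extended by zero. -/
structure IsIntegrableLogConcave {n : ℕ} (f : EuclideanSpace ℝ (Fin n) → ℝ) : Prop where
  nonneg : ∀ x, 0 ≤ f x
  logConcave : ∀ x y : EuclideanSpace ℝ (Fin n), ∀ t ∈ Set.Icc (0 : ℝ) 1,
    f x ^ (1 - t) * f y ^ t ≤ f ((1 - t) • x + t • y)
  integrable : Integrable f volume

/-- `c` is an `s`-cover of `σ`: all members are subsets of `σ`, and every element of `σ` lies in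
exactly `s` members of the family. -/
def IsCover {n : ℕ} {ι : Type} [Fintype ι] (s : ℕ) (σ : Finset (Fin n))
    (c : ι → Finset (Fin n)) : Prop :=
  (∀ i, c i ⊆ σ) ∧ ∀ j ∈ σ, (Finset.univ.filter fun i => j ∈ c i).card = s

/-- `c` is a `1`-reducible `s`-cover of `σ`: an `s`-cover whose members can be distributed into
`s` blocks (`b i` is the block of the `i`-th member), each of which is a `1`-cover of `σ`. -/
def IsOneReducibleCover {n m : ℕ} (s : ℕ) (σ : Finset (Fin n))
    (c : Fin m → Finset (Fin n)) : Prop :=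
  IsCover s σ c ∧
    ∃ b : Fin m → Fin s, ∀ k : Fin s, IsCover 1 σ (fun i : {i : Fin m // b i = k} => c i)

/-- The coordinate subspace `H_σ = span {e_i : i ∈ σ}` of `ℝⁿ`. -/
noncomputable def coordSubspace {n : ℕ} (σ : Finset (Fin n)) :
    Submodule ℝ (EuclideanSpace ℝ (Fin n)) :=
  Submodule.span ℝ ((fun i => EuclideanSpace.single i (1 : ℝ)) '' (σ : Set (Fin n)))

/-- The integral, with values in `[0, ∞]`, of a nonnegative function `f` over the affine subspace
`x + S`, with respect to the Lebesgue measure of dimension `dim S`. -/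
noncomputable def affineIntegral {n : ℕ} (f : EuclideanSpace ℝ (Fin n) → ℝ)
    (S : Submodule ℝ (EuclideanSpace ℝ (Fin n))) (x : EuclideanSpace ℝ (Fin n)) : ℝ≥0∞ :=
  ∫⁻ y : S, ENNReal.ofReal (f (x + (y : EuclideanSpace ℝ (Fin n))))

/-! Integrating `f` over the coordinates outside `σ` gives a marginal `F` of the `σ`-coordinates. It
is log-concave by Prékopa's theorem, bounded by the supremum `S` in the statement, and has total
integral `T = ∫ f`. The integral of `f` over the orthogonal complement of `H_{σ_j}` is the integral
of `F` over the coordinate section through `0` indexed by `σ \ σ_j`. Each of the `m - s` blocks of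
the cover partitions `σ`, so it is enough to bound products of integrals over complementary sections
and to multiply over blocks.

For a convex `K` in `ℝ^ι × ℝ^κ` with coordinate sections `A`, `B` through `0`, the bound is `|ι|!
|A| · |κ|! |B| ≤ (|ι| + |κ|)! |K|`. The factorials arise as `∫ e^{-r} r^d dr = d!`: if `y ∈ r A` and
`z ∈ s B`, then `(y, z) ∈ (r + s) K`, and exponential weights multiply (`expDilate_mul_le`,
`lintegral_expDilate`). Applying this to superlevel sets, with Chebyshev's inequality for the
monotone level functions, gives the bound for quasi-concave functions at the cost of one factor `sup
F` (`IsQuasiConcave.lintegral_sections_le`). Induction handles a partition into any number of pieces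
(`IsQuasiConcave.prod_lmarginal_le`). -/

/-- Log-concavity for functions with values in `[0, ∞]`. -/
def IsLogConcave {E : Type*} [AddCommGroup E] [Module ℝ E] (f : E → ℝ≥0∞) : Prop :=
  ∀ x y, ∀ a b : ℝ, 0 < a → 0 < b → a + b = 1 → f x ^ a * f y ^ b ≤ f (a • x + b • y)

/-- Quasi-concavity for functions with values in `[0, ∞]`. -/
def IsQuasiConcave {E : Type*} [AddCommGroup E] [Module ℝ E] (f : E → ℝ≥0∞) : Prop :=
  ∀ x y, ∀ a b : ℝ, 0 < a → 0 < b → a + b = 1 → min (f x) (f y) ≤ f (a • x + b • y)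

/-! ### Concavity and measurability -/

section Concavity

variable {E F : Type*} [AddCommGroup E] [Module ℝ E] [AddCommGroup F] [Module ℝ F]

theorem IsLogConcave.isQuasiConcave {f : E → ℝ≥0∞} (hf : IsLogConcave f) : IsQuasiConcave f := by
  intro x y a b ha hb hab
  refine le_trans ?_ (hf x y a b ha hb hab)
  calc min (f x) (f y) = min (f x) (f y) ^ a * min (f x) (f y) ^ b := by
        rw [← ENNReal.rpow_add_of_nonneg _ _ ha.le hb.le, hab, ENNReal.rpow_one]
    _ ≤ _ := by
        gcongr
        · exact min_le_left _ _
        · exact min_le_right _ _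

theorem IsQuasiConcave.convex_lt {f : E → ℝ≥0∞} (hf : IsQuasiConcave f) (t : ℝ≥0∞) :
    Convex ℝ {x | t < f x} := by
  rw [convex_iff_forall_pos]
  intro x hx y hy a b ha hb hab
  exact lt_of_lt_of_le (lt_min hx hy) (hf x y a b ha hb hab)

/-- A map that preserves convex combinations. -/
def PreservesConvexCombos (g : F → E) : Prop :=
  ∀ x y, ∀ a b : ℝ, a + b = 1 → g (a • x + b • y) = a • g x + b • g y

theorem IsLogConcave.comp {f : E → ℝ≥0∞} (hf : IsLogConcave f) {g : F → E}
    (hg : PreservesConvexCombos g) : IsLogConcave (f ∘ g) := by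
  intro x y a b ha hb hab
  simp only [Function.comp, hg x y a b hab]
  exact hf _ _ a b ha hb hab

theorem IsQuasiConcave.comp {f : E → ℝ≥0∞} (hf : IsQuasiConcave f) {g : F → E}
    (hg : PreservesConvexCombos g) : IsQuasiConcave (f ∘ g) := by
  intro x y a b ha hb hab
  simp only [Function.comp, hg x y a b hab]
  exact hf _ _ a b ha hb hab

end Concavity

/-- Superlevel sets are convex, hence null measurable. This supplies the measurability needed for
Tonelli. -/
theorem IsQuasiConcave.aemeasurable {E : Type*} [NormedAddCommGroup E] [NormedSpace ℝ E]
    [MeasurableSpace E] [BorelSpace E] [FiniteDimensional ℝ E] (μ : Measure E) [μ.IsAddHaarMeasure]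
    {f : E → ℝ≥0∞} (hf : IsQuasiConcave f) : AEMeasurable f μ := by
  apply NullMeasurable.aemeasurable
  have : @Measurable E ℝ≥0∞ (NullMeasurableSpace.instMeasurableSpace (μ := μ)) _ f :=
    @measurable_of_Ioi ℝ≥0∞ E _ _ _ (NullMeasurableSpace.instMeasurableSpace (μ := μ)) _ _ _ f
      (fun t => (hf.convex_lt t).nullMeasurableSet μ)
  exact fun s hs => this hs

/-! ### Layer cake and the one-dimensional Prékopa–Leindler inequality -/

theorem lintegral_min_one_eq_lintegral_meas_lt {α : Type*} [MeasurableSpace α] (μ : Measure α)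
    {g : α → ℝ≥0∞} (hg : AEMeasurable g μ) :
    ∫⁻ x, min (g x) 1 ∂μ = ∫⁻ t in Set.Ioo (0 : ℝ) 1, μ {x | ENNReal.ofReal t < g x} := by
  have hm : AEMeasurable (fun x => min (g x) 1) μ := hg.min aemeasurable_const
  have hfin : ∀ x, min (g x) 1 ≠ ∞ := fun x => ne_top_of_le_ne_top ENNReal.one_ne_top (min_le_right _ _)
  have h1 := lintegral_eq_lintegral_meas_lt μ (f := fun x => (min (g x) 1).toReal)
    (Filter.Eventually.of_forall fun x => ENNReal.toReal_nonneg) hm.ennreal_toReal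
  simp_rw [ENNReal.ofReal_toReal (hfin _)] at h1
  rw [h1, ← Set.Ioo_union_Ici_eq_Ioi (zero_lt_one' ℝ),
    lintegral_union measurableSet_Ici]
  · have h2 : ∫⁻ t in Set.Ici (1 : ℝ), μ {a | t < (min (g a) 1).toReal} = 0 := by
      rw [setLIntegral_congr_fun (g := fun _ => 0) measurableSet_Ici, lintegral_zero]
      intro t ht
      have : {a | t < (min (g a) 1).toReal} = ∅ := by
        ext a
        simp only [Set.mem_ofPred_eq, Set.mem_empty_iff_false, iff_false, not_lt]
        refine le_trans ?_ (Set.mem_Ici.1 ht)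
        exact ENNReal.toReal_le_of_le_ofReal zero_le_one (by simp)
      simp [this]
    rw [h2, add_zero]
    refine setLIntegral_congr_fun measurableSet_Ioo fun t ht => ?_
    congr 1
    ext a
    simp only [Set.mem_ofPred_eq]
    rw [← ENNReal.ofReal_lt_iff_lt_toReal ht.1.le (hfin a), lt_min_iff]
    simp [ht.2]
  · rw [Set.disjoint_left]
    intro x hx hx'
    exact absurd hx.2 (not_lt.2 hx')

/-- One-dimensional Brunn–Minkowski. For compact `K`, `L`, the translates `K + min L` and `max K +
L` lie in `C` and meet in a single point; inner regularity does the rest. -/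
theorem volume_add_le_of_forall_add_mem {A B C : Set ℝ} (hA : MeasurableSet A)
    (hB : MeasurableSet B) (hA0 : A.Nonempty) (hB0 : B.Nonempty)
    (h : ∀ x ∈ A, ∀ y ∈ B, x + y ∈ C) : volume A + volume B ≤ volume C := by
  have key : ∀ K ⊆ A, IsCompact K → K.Nonempty → ∀ L ⊆ B, IsCompact L → L.Nonempty →
      volume K + volume L ≤ volume C := by
    intro K hKA hK hK0 L hLB hL hL0
    obtain ⟨k, hk, hkmax⟩ := hK.exists_isGreatest hK0
    obtain ⟨l, hl, hlmin⟩ := hL.exists_isLeast hL0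
    have e1 : volume ((fun x => x + l) '' K) = volume K := by
      simp [Set.image_add_right, measure_preimage_add_right]
    have e2 : volume ((fun x => k + x) '' L \ {k + l}) = volume L := by
      rw [measure_sdiff_null (by simp)]
      simp [Set.image_add_left, measure_preimage_add]
    rw [← e1, ← e2, ← measure_union]
    · apply measure_mono
      rintro _ (⟨x, hx, rfl⟩ | ⟨⟨x, hx, rfl⟩, -⟩)
      · exact h _ (hKA hx) _ (hLB hl)
      · exact h _ (hKA hk) _ (hLB hx)
    · rw [Set.disjoint_left]
      rintro _ ⟨x, hx, rfl⟩ ⟨⟨y, hy, hxy⟩, hne⟩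
      have h1 := hkmax hx
      have h2 := hlmin hy
      apply hne
      simp only [Set.mem_singleton_iff]
      dsimp only at hxy ⊢
      linarith
    · exact ((hL.image (by fun_prop)).measurableSet).diff (measurableSet_singleton _)
  obtain ⟨a0, ha0⟩ := hA0
  obtain ⟨b0, hb0⟩ := hB0
  -- Inserting a fixed point of `A` and of `B` removes the nonemptiness conditions.
  have key2 : ∀ K ⊆ A, IsCompact K → ∀ L ⊆ B, IsCompact L → volume K + volume L ≤ volume C := by
    intro K hKA hK L hLB hL
    refine le_trans (add_le_add (measure_mono (Set.subset_insert a0 K))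
      (measure_mono (Set.subset_insert b0 L))) ?_
    exact key _ (Set.insert_subset ha0 hKA) (hK.insert _) (Set.insert_nonempty _ _) _
      (Set.insert_subset hb0 hLB) (hL.insert _) (Set.insert_nonempty _ _)
  rw [hA.measure_eq_iSup_isCompact, hB.measure_eq_iSup_isCompact]
  simp only [iSup_and']
  exact ENNReal.biSup_add_biSup_le' ⟨∅, by simp⟩ ⟨∅, by simp⟩
    fun K hK L hL => key2 K hK.1 hK.2 L hL.1 hL.2

theorem ENNReal.rpow_mul_rpow_le_add (x y : ℝ≥0∞) {a b : ℝ} (ha : 0 < a) (hb : 0 < b)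
    (hab : a + b = 1) : x ^ a * y ^ b ≤ ENNReal.ofReal a * x + ENNReal.ofReal b * y := by
  have hc : (a⁻¹).HolderConjugate b⁻¹ := by
    rw [Real.holderConjugate_iff]
    refine ⟨(one_lt_inv₀ ha).2 (by linarith), by simpa using hab⟩
  have h := ENNReal.young_inequality (x ^ a) (y ^ b) hc
  rw [← ENNReal.rpow_mul, ← ENNReal.rpow_mul, mul_inv_cancel₀ ha.ne', mul_inv_cancel₀ hb.ne',
    ENNReal.rpow_one, ENNReal.rpow_one, ENNReal.ofReal_inv_of_pos ha, ENNReal.ofReal_inv_of_pos hb,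
    div_eq_mul_inv, div_eq_mul_inv, inv_inv, inv_inv] at h
  rwa [mul_comm (ENNReal.ofReal a), mul_comm (ENNReal.ofReal b)]

open scoped Pointwise in
-- With both suprema equal to `1`, the superlevel sets of `p` and `q` are nonempty at every level `t
-- < 1`, so Brunn–Minkowski applies level by level. The weighted AM–GM inequality turns the
-- resulting sum into the product.
theorem prekopa_leindler_real_of_iSup_eq_one {p q h : ℝ → ℝ≥0∞} (hp : Measurable p)
    (hq : Measurable q) (hh : Measurable h) {a b : ℝ} (ha : 0 < a) (hb : 0 < b) (hab : a + b = 1)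
    (H : ∀ s t, p s ^ a * q t ^ b ≤ h (a * s + b * t)) (hp1 : ⨆ s, p s = 1) (hq1 : ⨆ s, q s = 1) :
    (∫⁻ s, p s) ^ a * (∫⁻ s, q s) ^ b ≤ ∫⁻ s, h s := by
  have e : ∀ g : ℝ → ℝ≥0∞, ⨆ s, g s = 1 → ∫⁻ s, g s = ∫⁻ s, min (g s) 1 := by
    intro g hg
    refine lintegral_congr fun s => (min_eq_left ?_).symm
    exact hg ▸ le_iSup g s
  have hmeas : ∀ g : ℝ → ℝ≥0∞, Measurable fun t : ℝ => volume {x | ENNReal.ofReal t < g x} := by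
    intro g
    apply Antitone.measurable
    intro s t hst
    exact measure_mono fun x hx => lt_of_le_of_lt (ENNReal.ofReal_le_ofReal hst) hx
  calc (∫⁻ s, p s) ^ a * (∫⁻ s, q s) ^ b
      ≤ ENNReal.ofReal a * (∫⁻ s, p s) + ENNReal.ofReal b * (∫⁻ s, q s) :=
        ENNReal.rpow_mul_rpow_le_add _ _ ha hb hab
    _ = ∫⁻ t in Set.Ioo (0 : ℝ) 1, (ENNReal.ofReal a * volume {x | ENNReal.ofReal t < p x}
          + ENNReal.ofReal b * volume {x | ENNReal.ofReal t < q x}) := by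
        rw [e p hp1, e q hq1, lintegral_min_one_eq_lintegral_meas_lt _ hp.aemeasurable,
          lintegral_min_one_eq_lintegral_meas_lt _ hq.aemeasurable,
          lintegral_add_left ((hmeas p).const_mul _), lintegral_const_mul _ (hmeas p),
          lintegral_const_mul _ (hmeas q)]
    _ ≤ ∫⁻ t in Set.Ioo (0 : ℝ) 1, volume {x | ENNReal.ofReal t < h x} := by
        refine setLIntegral_mono' measurableSet_Ioo fun t ht => ?_
        have hne : ∀ g : ℝ → ℝ≥0∞, ⨆ s, g s = 1 → {x | ENNReal.ofReal t < g x}.Nonempty := by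
          intro g hg
          have : ENNReal.ofReal t < ⨆ s, g s := by
            rw [hg]; simpa using ht.2
          obtain ⟨s, hs⟩ := lt_iSup_iff.1 this
          exact ⟨s, hs⟩
        have hv : ∀ (c : ℝ), 0 < c → ∀ s : Set ℝ, ENNReal.ofReal c * volume s
            = volume (c • s) := by
          intro c hc s
          rw [Measure.addHaar_smul]
          simp [abs_of_pos hc]
        rw [hv a ha, hv b hb]
        apply volume_add_le_of_forall_add_mem
        · exact (measurableSet_lt measurable_const hp).const_smul_of_ne_zero ha.ne'
        · exact (measurableSet_lt measurable_const hq).const_smul_of_ne_zero hb.ne'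
        · exact (hne p hp1).smul_set
        · exact (hne q hq1).smul_set
        · rintro _ ⟨x, hx, rfl⟩ _ ⟨y, hy, rfl⟩
          refine lt_of_lt_of_le (lt_min hx hy) (le_trans ?_ (H x y))
          calc min (p x) (q y) = min (p x) (q y) ^ a * min (p x) (q y) ^ b := by
                rw [← ENNReal.rpow_add_of_nonneg _ _ ha.le hb.le, hab, ENNReal.rpow_one]
            _ ≤ _ := by
                gcongr
                · exact min_le_left _ _
                · exact min_le_right _ _
    _ = ∫⁻ x, min (h x) 1 := (lintegral_min_one_eq_lintegral_meas_lt _ hh.aemeasurable).symm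
    _ ≤ ∫⁻ s, h s := lintegral_mono fun s => min_le_left _ _

theorem prekopa_leindler_real_of_bounded {p q h : ℝ → ℝ≥0∞} (hp : Measurable p)
    (hq : Measurable q) (hh : Measurable h) {a b : ℝ} (ha : 0 < a) (hb : 0 < b) (hab : a + b = 1)
    (H : ∀ s t, p s ^ a * q t ^ b ≤ h (a * s + b * t)) (hp1 : ⨆ s, p s ≠ ∞) (hq1 : ⨆ s, q s ≠ ∞) :
    (∫⁻ s, p s) ^ a * (∫⁻ s, q s) ^ b ≤ ∫⁻ s, h s := by
  set P := ⨆ s, p s with hP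
  set Q := ⨆ s, q s with hQ
  have z : ∀ g : ℝ → ℝ≥0∞, ⨆ s, g s = 0 → ∫⁻ s, g s = 0 := by
    intro g hg
    simp [ENNReal.iSup_eq_zero.1 hg]
  by_cases hP0 : P = 0
  · simp [z p hP0, ENNReal.zero_rpow_of_pos ha]
  by_cases hQ0 : Q = 0
  · simp [z q hQ0, ENNReal.zero_rpow_of_pos hb]
  have hPa0 : P ^ a ≠ 0 := by simp [hP0, hp1]
  have hPat : P ^ a ≠ ∞ := by simp [hP0, hp1]
  have hQb0 : Q ^ b ≠ 0 := by simp [hQ0, hq1]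
  have hQbt : Q ^ b ≠ ∞ := by simp [hQ0, hq1]
  have key := prekopa_leindler_real_of_iSup_eq_one (p := fun s => P⁻¹ * p s)
    (q := fun s => Q⁻¹ * q s) (h := fun s => ((P ^ a)⁻¹ * (Q ^ b)⁻¹) * h s)
    (hp.const_mul _) (hq.const_mul _) (hh.const_mul _) ha hb hab
    (by
      intro s t
      rw [ENNReal.mul_rpow_of_nonneg _ _ ha.le, ENNReal.mul_rpow_of_nonneg _ _ hb.le,
        ENNReal.inv_rpow, ENNReal.inv_rpow, mul_mul_mul_comm]
      gcongr
      exact H s t)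
    (by rw [← ENNReal.mul_iSup, ← hP, ENNReal.inv_mul_cancel hP0 hp1])
    (by rw [← ENNReal.mul_iSup, ← hQ, ENNReal.inv_mul_cancel hQ0 hq1])
  rw [lintegral_const_mul _ hp, lintegral_const_mul _ hq, lintegral_const_mul _ hh,
    ENNReal.mul_rpow_of_nonneg _ _ ha.le, ENNReal.mul_rpow_of_nonneg _ _ hb.le,
    ENNReal.inv_rpow, ENNReal.inv_rpow, mul_mul_mul_comm] at key
  rwa [ENNReal.mul_le_mul_iff_right] at key
  · simp [hPat, hQbt]
  · exact ENNReal.mul_ne_top (by simpa using hPa0) (by simpa using hQb0)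

theorem tendsto_lintegral_min_natCast {α : Type*} [MeasurableSpace α] {μ : Measure α}
    {p : α → ℝ≥0∞} (hp : AEMeasurable p μ) :
    Filter.Tendsto (fun N : ℕ => ∫⁻ s, min (p s) N ∂μ) Filter.atTop (nhds (∫⁻ s, p s ∂μ)) := by
  apply lintegral_tendsto_of_tendsto_of_monotone
  · exact fun n => hp.min aemeasurable_const
  · refine Filter.Eventually.of_forall fun x m n hmn => ?_
    exact min_le_min le_rfl (by exact_mod_cast hmn)
  · refine Filter.Eventually.of_forall fun x => ?_
    have := (tendsto_const_nhds (x := p x) (f := Filter.atTop)).min ENNReal.tendsto_nat_nhds_top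
    simpa using this

/-- The one-dimensional Prékopa–Leindler inequality. -/
theorem prekopa_leindler_real {p q h : ℝ → ℝ≥0∞} (hp : Measurable p)
    (hq : Measurable q) (hh : Measurable h) {a b : ℝ} (ha : 0 < a) (hb : 0 < b) (hab : a + b = 1)
    (H : ∀ s t, p s ^ a * q t ^ b ≤ h (a * s + b * t)) :
    (∫⁻ s, p s) ^ a * (∫⁻ s, q s) ^ b ≤ ∫⁻ s, h s := by
  -- Multiplication on `[0, ∞]` is discontinuous at `(0, ∞)`, so zero integrals are split off before
  -- the truncation level tends to infinity.
  by_cases hp0 : ∫⁻ s, p s = 0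
  · simp [hp0, ENNReal.zero_rpow_of_pos ha]
  by_cases hq0 : ∫⁻ s, q s = 0
  · simp [hq0, ENNReal.zero_rpow_of_pos hb]
  have hb' : ∀ (g : ℝ → ℝ≥0∞) (N : ℕ), ⨆ s, min (g s) (N : ℝ≥0∞) ≠ ∞ := fun g N =>
    ne_top_of_le_ne_top (ENNReal.natCast_ne_top N) (iSup_le fun s => min_le_right _ _)
  have t1 := ((ENNReal.continuous_rpow_const (y := a)).tendsto _).comp
    (tendsto_lintegral_min_natCast hp.aemeasurable (μ := volume))
  have t2 := ((ENNReal.continuous_rpow_const (y := b)).tendsto _).comp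
    (tendsto_lintegral_min_natCast hq.aemeasurable (μ := volume))
  refine le_of_tendsto (ENNReal.Tendsto.mul t1 (Or.inl ?_) t2 (Or.inl ?_))
    (Filter.Eventually.of_forall fun N => ?_)
  · simp [ENNReal.rpow_eq_zero_iff, hp0, ha.not_gt]
  · simp [ENNReal.rpow_eq_zero_iff, hq0, hb.not_gt]
  · refine prekopa_leindler_real_of_bounded (hp.min measurable_const) (hq.min measurable_const) hh
      ha hb hab (fun s t => le_trans ?_ (H s t)) (hb' p N) (hb' q N)
    gcongr
    · exact min_le_left _ _
    · exact min_le_left _ _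

theorem IsQuasiConcave.measurable_real {f : ℝ → ℝ≥0∞} (hf : IsQuasiConcave f) : Measurable f :=
  measurable_of_Ioi fun t => (hf.convex_lt t).ordConnected.measurableSet

instance isAddHaarMeasure_volume_prod_pi {ι κ : Type*} [Fintype ι] [Fintype κ] :
    (volume : Measure ((ι → ℝ) × (κ → ℝ))).IsAddHaarMeasure :=
  Measure.prod.instIsAddHaarMeasure volume volume

/-! ### Marginals and Prékopa's theorem -/

section Marginal

variable {ι : Type*} [DecidableEq ι]

theorem preservesConvexCombos_update (x : ι → ℝ) (i : ι) :
    PreservesConvexCombos (fun t : ℝ => Function.update x i t) := by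
  intro s t a b hab
  ext j
  by_cases hj : j = i
  · subst hj; simp
  · simp [hj, ← add_mul, hab]

theorem preservesConvexCombos_updateFinset_updateFinset (x : ι → ℝ) (s t : Finset ι) :
    PreservesConvexCombos (fun y : (s → ℝ) × (t → ℝ) =>
      Function.updateFinset (Function.updateFinset x s y.1) t y.2) := by
  intro y z a b hab
  ext j
  by_cases hj : j ∈ t
  · simp [Function.updateFinset, hj]
  · by_cases hj' : j ∈ s
    · simp [Function.updateFinset, hj, hj']
    · simp [Function.updateFinset, hj, hj', ← add_mul, hab]

theorem lmarginal_union_eq_lintegral_prod (f : (ι → ℝ) → ℝ≥0∞)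
    {s t : Finset ι} (hst : Disjoint s t) (x : ι → ℝ) :
    lmarginal (fun _ => volume) (s ∪ t) f x = ∫⁻ y : (s → ℝ) × (t → ℝ),
      f (Function.updateFinset (Function.updateFinset x s y.1) t y.2) := by
  simp_rw [Function.updateFinset_updateFinset hst]
  have := (measurePreserving_piFinsetUnion hst (fun _ : ι => (volume : Measure ℝ))).lintegral_map_equiv
    (fun y => f (Function.updateFinset x (s ∪ t) y))
  exact this

theorem IsQuasiConcave.lmarginal_union {f : (ι → ℝ) → ℝ≥0∞} (hf : IsQuasiConcave f)
    {s t : Finset ι} (hst : Disjoint s t) (x : ι → ℝ) :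
    lmarginal (fun _ => volume) (s ∪ t) f x
      = lmarginal (fun _ => volume) s (lmarginal (fun _ => volume) t f) x := by
  rw [lmarginal_union_eq_lintegral_prod f hst, Measure.volume_eq_prod, lintegral_prod]
  · rfl
  · exact (hf.comp (preservesConvexCombos_updateFinset_updateFinset x s t)).aemeasurable
      (volume : Measure ((s → ℝ) × (t → ℝ)))

theorem IsLogConcave.lmarginal_singleton {f : (ι → ℝ) → ℝ≥0∞} (hf : IsLogConcave f) (i : ι) :
    IsLogConcave (lmarginal (fun _ => volume) {i} f) := by
  rw [MeasureTheory.lmarginal_singleton]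
  intro x y a b ha hb hab
  have hm : ∀ z, Measurable fun t : ℝ => f (Function.update z i t) := fun z =>
    (hf.comp (preservesConvexCombos_update z i)).isQuasiConcave.measurable_real
  refine prekopa_leindler_real (hm x) (hm y) (hm _) ha hb hab fun s t => ?_
  refine (hf _ _ a b ha hb hab).trans_eq ?_
  congr 1
  ext j
  by_cases hj : j = i
  · subst hj; simp
  · simp [hj]

/-- **Prékopa's theorem**: marginals of log-concave functions are log-concave. -/
theorem IsLogConcave.lmarginal {f : (ι → ℝ) → ℝ≥0∞} (hf : IsLogConcave f) (s : Finset ι) :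
    IsLogConcave (lmarginal (fun _ => volume) s f) := by
  induction s using Finset.induction_on with
  | empty => simpa using hf
  | insert i s hi ih =>
    have : MeasureTheory.lmarginal (fun _ => volume) (insert i s) f = MeasureTheory.lmarginal
        (fun _ => volume) {i} (MeasureTheory.lmarginal (fun _ => volume) s f) := by
      ext x
      rw [Finset.insert_eq,
        hf.isQuasiConcave.lmarginal_union (Finset.disjoint_singleton_left.mpr hi)]
    rw [this]
    exact ih.lmarginal_singleton i

end Marginal

/-! ### Exponential averages of dilates -/

theorem lintegral_exp_neg_Ioi (c : ℝ) :
    ∫⁻ r in Set.Ioi c, ENNReal.ofReal (Real.exp (-r)) = ENNReal.ofReal (Real.exp (-c)) := by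
  rw [← ofReal_integral_eq_lintegral_ofReal (integrableOn_exp_neg_Ioi c)
    (Filter.Eventually.of_forall fun x => (Real.exp_pos _).le), integral_exp_neg_Ioi]

theorem lintegral_exp_neg_mul_pow (n : ℕ) :
    ∫⁻ r in Set.Ioi (0 : ℝ), ENNReal.ofReal (Real.exp (-r)) * ENNReal.ofReal (r ^ n)
      = (n ! : ℕ) := by
  have h0 : (0 : ℝ) < n + 1 := by positivity
  have hint := Real.GammaIntegral_convergent h0
  have hG := Real.Gamma_eq_integral h0
  simp only [add_sub_cancel_right, Real.rpow_natCast] at hint hG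
  have : ∫⁻ r in Set.Ioi (0 : ℝ), ENNReal.ofReal (Real.exp (-r)) * ENNReal.ofReal (r ^ n)
      = ∫⁻ r in Set.Ioi (0 : ℝ), ENNReal.ofReal (Real.exp (-r) * r ^ n) :=
    lintegral_congr fun r => (ENNReal.ofReal_mul (Real.exp_pos _).le).symm
  rw [this, ← ofReal_integral_eq_lintegral_ofReal hint, ← hG, Real.Gamma_nat_eq_factorial]
  · simp
  · filter_upwards [ae_restrict_mem measurableSet_Ioi] with r hr
    have : (0 : ℝ) < r := hr
    positivity

/-- The Laplace-type transform of the dilates of a set at a point: the exponential measure of the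
set of `r > 0` with `x ∈ r • A`. -/
noncomputable def expDilate {E : Type*} [AddCommGroup E] [Module ℝ E] (A : Set E) (x : E) :
    ℝ≥0∞ :=
  ∫⁻ r in Set.Ioi (0 : ℝ), ENNReal.ofReal (Real.exp (-r)) * A.indicator 1 (r⁻¹ • x)

section

variable {E : Type*} [NormedAddCommGroup E] [NormedSpace ℝ E] [MeasurableSpace E] [BorelSpace E]
  [FiniteDimensional ℝ E]

theorem measurable_exp_neg_mul_indicator {A : Set E} (hA : MeasurableSet A) :
    Measurable fun p : E × ℝ =>
      ENNReal.ofReal (Real.exp (-p.2)) * A.indicator (1 : E → ℝ≥0∞) (p.2⁻¹ • p.1) := by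
  have h1 : Measurable (A.indicator (1 : E → ℝ≥0∞)) := measurable_one.indicator hA
  have h2 : Measurable fun p : E × ℝ => p.2⁻¹ • p.1 := by fun_prop
  exact (by fun_prop : Measurable fun p : E × ℝ => ENNReal.ofReal (Real.exp (-p.2))).mul
    (h1.comp h2)

theorem measurable_expDilate {A : Set E} (hA : MeasurableSet A) : Measurable (expDilate A) :=
  (measurable_exp_neg_mul_indicator hA).lintegral_prod_right'

/-- By Tonelli, the dilate `r • A` contributes `r ^ d * μ A`, and the exponential weight integrates
`r ^ d` to `d!`. -/
theorem lintegral_expDilate (μ : Measure E) [μ.IsAddHaarMeasure] {A : Set E}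
    (hA : MeasurableSet A) :
    ∫⁻ x, expDilate A x ∂μ = ((Module.finrank ℝ E)! : ℕ) * μ A := by
  unfold expDilate
  rw [lintegral_lintegral_swap (measurable_exp_neg_mul_indicator hA).aemeasurable,
    ← lintegral_exp_neg_mul_pow, ← lintegral_mul_const _ (by fun_prop)]
  refine setLIntegral_congr_fun measurableSet_Ioi fun r hr => ?_
  have hr : (0 : ℝ) < r := hr
  have hp : Measurable fun x : E => r⁻¹ • x := by fun_prop
  rw [lintegral_const_mul' _ _ ENNReal.ofReal_ne_top]
  have : ∀ x : E, A.indicator (1 : E → ℝ≥0∞) (r⁻¹ • x)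
      = ((fun x => r⁻¹ • x) ⁻¹' A).indicator 1 x := fun x => rfl
  simp_rw [this]
  rw [lintegral_indicator_one (hp hA), Measure.addHaar_preimage_smul _ (inv_ne_zero hr.ne'),
    mul_assoc]
  congr 3
  rw [inv_pow, inv_inv, abs_of_pos (by positivity)]

end

/-- For a fixed `r` with `y ∈ r • A`, shifting the integration variable of `expDilate B z` by `r`
lands in the integral for `C`, with weight `e^{-r} e^{-s} = e^{-(r+s)}`. Moreover `expDilate A y` is
at most the supremum of `e^{-r}` over such `r`. -/
theorem expDilate_mul_le {E F : Type*} [AddCommGroup E] [Module ℝ E] [AddCommGroup F] [Module ℝ F]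
    {A : Set E} {B : Set F} {C : Set (E × F)}
    (h : ∀ y ∈ A, ∀ z ∈ B, ∀ a b : ℝ, 0 < a → 0 < b → a + b = 1 → (a • y, b • z) ∈ C)
    (y : E) (z : F) : expDilate A y * expDilate B z ≤ expDilate C (y, z) := by
  set R : Set ℝ := {r | 0 < r ∧ r⁻¹ • y ∈ A} with hR
  set S : ℝ≥0∞ := ⨆ r ∈ R, ENNReal.ofReal (Real.exp (-r)) with hS
  have step1 : ∀ r ∈ R, ENNReal.ofReal (Real.exp (-r)) * expDilate B z ≤ expDilate C (y, z) := by
    intro r hr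
    have hr0 : 0 < r := hr.1
    unfold expDilate
    rw [← lintegral_const_mul' _ _ ENNReal.ofReal_ne_top, ← lintegral_indicator measurableSet_Ioi,
      ← lintegral_indicator measurableSet_Ioi]
    refine le_trans (lintegral_mono fun s => ?_) (lintegral_add_left_eq_self _ r).le
    by_cases hs : 0 < s
    · rw [Set.indicator_of_mem (show s ∈ Set.Ioi (0 : ℝ) from hs),
        Set.indicator_of_mem (show r + s ∈ Set.Ioi (0 : ℝ) from add_pos hr0 hs), ← mul_assoc,
        ← ENNReal.ofReal_mul (Real.exp_pos _).le, ← Real.exp_add, neg_add]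
      gcongr
      by_cases hB : s⁻¹ • z ∈ B
      · have hmem : (r + s)⁻¹ • (y, z) ∈ C := by
          have := h _ hr.2 _ hB (r / (r + s)) (s / (r + s)) (by positivity) (by positivity)
            (by field_simp)
          rw [smul_smul, smul_smul] at this
          convert this using 1
          rw [Prod.smul_mk]
          congr 2 <;> field_simp
        rw [Set.indicator_of_mem hmem, Set.indicator_of_mem hB]
        simp
      · rw [Set.indicator_of_notMem hB]
        exact zero_le
    · rw [Set.indicator_of_notMem (show s ∉ Set.Ioi (0 : ℝ) from hs)]
      exact zero_le
  have step2 : expDilate A y ≤ S := by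
    have e : expDilate A y ≤ ∫⁻ r, R.indicator (fun r => ENNReal.ofReal (Real.exp (-r))) r := by
      unfold expDilate
      rw [← lintegral_indicator measurableSet_Ioi]
      refine lintegral_mono fun r => ?_
      by_cases hr : 0 < r
      · rw [Set.indicator_of_mem (show r ∈ Set.Ioi (0 : ℝ) from hr)]
        by_cases hA : r⁻¹ • y ∈ A
        · rw [Set.indicator_of_mem hA, Set.indicator_of_mem (show r ∈ R from ⟨hr, hA⟩)]
          simp
        · rw [Set.indicator_of_notMem hA]
          simp
      · rw [Set.indicator_of_notMem (show r ∉ Set.Ioi (0 : ℝ) from hr)]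
        exact zero_le
    refine e.trans ?_
    rcases R.eq_empty_or_nonempty with hRe | ⟨r1, hr1⟩
    · simp [hRe]
    have hle : ∀ r ∈ R, ENNReal.ofReal (Real.exp (-r)) ≤ S := fun r hr =>
      le_iSup₂ (f := fun r (_ : r ∈ R) => ENNReal.ofReal (Real.exp (-r))) r hr
    have hS1 : S ≤ 1 := iSup₂_le fun r hr => by
      simpa using hr.1.le
    have hSt : S ≠ ∞ := ne_top_of_le_ne_top ENNReal.one_ne_top hS1
    have hS0 : 0 < S.toReal := ENNReal.toReal_pos
      (ne_of_gt (lt_of_lt_of_le (ENNReal.ofReal_pos.2 (Real.exp_pos _)) (hle r1 hr1))) hSt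
    -- Here `-log S` is the infimum of `R`, and the exponential measure of the half-line starting
    -- there is exactly `S`.
    have hsub : R ⊆ Set.Ici (-Real.log S.toReal) := by
      intro r hr
      have := (ENNReal.ofReal_le_iff_le_toReal hSt).1 (hle r hr)
      have := (Real.le_log_iff_exp_le hS0).2 this
      simp only [Set.mem_Ici]
      linarith
    calc ∫⁻ r, R.indicator (fun r => ENNReal.ofReal (Real.exp (-r))) r
        ≤ ∫⁻ r, (Set.Ici (-Real.log S.toReal)).indicator
            (fun r => ENNReal.ofReal (Real.exp (-r))) r :=
          lintegral_mono (Set.indicator_le_indicator_of_subset hsub fun _ => zero_le)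
      _ = S := by
          rw [lintegral_indicator measurableSet_Ici, setLIntegral_congr Ioi_ae_eq_Ici.symm,
            lintegral_exp_neg_Ioi, neg_neg, Real.exp_log hS0, ENNReal.ofReal_toReal hSt]
  calc expDilate A y * expDilate B z ≤ S * expDilate B z := by gcongr
    _ ≤ expDilate C (y, z) := by
      simp only [hS, ENNReal.iSup_mul]
      exact iSup₂_le step1

/-! ### The inequality for two complementary sections -/

/-- This is `(a' - a) * (b' - b) ≥ 0`, written without subtraction. -/
theorem ENNReal.mul_add_mul_le_of_le {a a' b b' : ℝ≥0∞} (ha : a ≤ a') (hb : b ≤ b') :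
    a' * b + a * b' ≤ a' * b' + a * b := by
  obtain ⟨c, rfl⟩ := exists_add_of_le ha
  obtain ⟨d, rfl⟩ := exists_add_of_le hb
  calc (a + c) * b + a * (b + d) ≤ (a + c) * b + a * (b + d) + c * d := le_self_add
    _ = _ := by ring

theorem lintegral_eq_zero_of_lintegral_min_one_eq_zero {α : Type*} [MeasurableSpace α]
    {μ : Measure α} {g : α → ℝ≥0∞} (hg : AEMeasurable g μ) (h : ∫⁻ x, min (g x) 1 ∂μ = 0) :
    ∫⁻ x, g x ∂μ = 0 := by
  rw [lintegral_eq_zero_iff' (hg.min aemeasurable_const)] at h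
  rw [lintegral_eq_zero_iff' hg]
  filter_upwards [h] with x hx
  simpa using hx

theorem preservesConvexCombos_mk_zero {ι κ : Type*} :
    PreservesConvexCombos (fun y : ι → ℝ => (y, (0 : κ → ℝ))) := by
  intro x y a b _
  simp

theorem preservesConvexCombos_zero_mk {ι κ : Type*} :
    PreservesConvexCombos (fun z : κ → ℝ => ((0 : ι → ℝ), z)) := by
  intro x y a b _
  simp

section Blocks

variable {ι κ : Type*} [Fintype ι] [Fintype κ]

theorem factorial_mul_volume_le {A : Set (ι → ℝ)} {B : Set (κ → ℝ)}
    {C : Set ((ι → ℝ) × (κ → ℝ))} (hA : MeasurableSet A) (hB : MeasurableSet B)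
    (hC : MeasurableSet C)
    (h : ∀ y ∈ A, ∀ z ∈ B, ∀ a b : ℝ, 0 < a → 0 < b → a + b = 1 → (a • y, b • z) ∈ C) :
    (((Fintype.card ι)! : ℕ) * volume A) * (((Fintype.card κ)! : ℕ) * volume B)
      ≤ ((Fintype.card ι + Fintype.card κ)! : ℕ) * volume C := by
  have e1 := lintegral_expDilate volume hA
  have e2 := lintegral_expDilate volume hB
  have e3 := lintegral_expDilate volume hC
  rw [Module.finrank_prod, Module.finrank_fintype_fun_eq_card,
    Module.finrank_fintype_fun_eq_card] at e3
  rw [Module.finrank_fintype_fun_eq_card] at e1 e2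
  rw [← e1, ← e2, ← e3, Measure.volume_eq_prod, ← lintegral_prod_mul
    (measurable_expDilate hA).aemeasurable (measurable_expDilate hB).aemeasurable]
  exact lintegral_mono fun p => expDilate_mul_le h p.1 p.2

theorem Convex.factorial_mul_volume_sections_le {K : Set ((ι → ℝ) × (κ → ℝ))} (hK : Convex ℝ K) :
    (((Fintype.card ι)! : ℕ) * volume {y | (y, (0 : κ → ℝ)) ∈ K})
      * (((Fintype.card κ)! : ℕ) * volume {z | ((0 : ι → ℝ), z) ∈ K})
      ≤ ((Fintype.card ι + Fintype.card κ)! : ℕ) * volume K := by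
  have c1 : Convex ℝ {y | (y, (0 : κ → ℝ)) ∈ K} :=
    hK.linear_preimage (LinearMap.inl ℝ (ι → ℝ) (κ → ℝ))
  have c2 : Convex ℝ {z | ((0 : ι → ℝ), z) ∈ K} :=
    hK.linear_preimage (LinearMap.inr ℝ (ι → ℝ) (κ → ℝ))
  -- Sections shrink to measurable subsets and `K` grows to a measurable hull, with no change of
  -- volume; the inclusion of convex combinations survives.
  obtain ⟨A, hAs, hA, hAe⟩ := (c1.nullMeasurableSet volume).exists_measurable_subset_ae_eq
  obtain ⟨B, hBs, hB, hBe⟩ := (c2.nullMeasurableSet volume).exists_measurable_subset_ae_eq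
  rw [← measure_congr hAe, ← measure_congr hBe, ← measure_toMeasurable K]
  refine factorial_mul_volume_le hA hB (measurableSet_toMeasurable _ _) ?_
  intro y hy z hz a b ha hb hab
  apply subset_toMeasurable
  have := hK (hAs hy) (hBs hz) ha.le hb.le hab
  simpa using this

/-- Chebyshev's association inequality: integrate the two-point rearrangement inequality over
independent copies `s`, `t`. -/
theorem lintegral_mul_lintegral_le_of_antitone {μ : Measure ℝ} [IsProbabilityMeasure μ]
    {α β : ℝ → ℝ≥0∞} (hα : Antitone α) (hβ : Antitone β) :
    (∫⁻ t, α t ∂μ) * (∫⁻ t, β t ∂μ) ≤ ∫⁻ t, α t * β t ∂μ := by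
  have mα := hα.measurable
  have mβ := hβ.measurable
  have key : ∫⁻ s, ∫⁻ t, (α s * β t + α t * β s) ∂μ ∂μ
      ≤ ∫⁻ s, ∫⁻ t, (α s * β s + α t * β t) ∂μ ∂μ := by
    refine lintegral_mono fun s => lintegral_mono fun t => ?_
    rcases le_total s t with h | h
    · exact ENNReal.mul_add_mul_le_of_le (hα h) (hβ h)
    · rw [add_comm (α s * β t), add_comm (α s * β s)]
      exact ENNReal.mul_add_mul_le_of_le (hα h) (hβ h)
  have l1 : ∫⁻ s, ∫⁻ t, (α s * β t + α t * β s) ∂μ ∂μ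
      = 2 * ((∫⁻ t, α t ∂μ) * (∫⁻ t, β t ∂μ)) := by
    simp_rw [lintegral_add_left (mβ.const_mul _), lintegral_const_mul _ mβ,
      lintegral_mul_const _ mα]
    rw [lintegral_add_left (mα.mul_const _), lintegral_mul_const _ mα, lintegral_const_mul _ mβ,
      two_mul]
  have l2 : ∫⁻ s, ∫⁻ t, (α s * β s + α t * β t) ∂μ ∂μ = 2 * ∫⁻ t, α t * β t ∂μ := by
    simp_rw [lintegral_add_left measurable_const, lintegral_const, measure_univ, mul_one]
    rw [lintegral_add_right _ measurable_const, lintegral_const, measure_univ, mul_one, two_mul]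
  rw [l1, l2] at key
  exact (ENNReal.mul_le_mul_iff_right two_ne_zero ENNReal.ofNat_ne_top).1 key

/-- Truncation at `1` confines the levels to `(0, 1)`, a probability space, as Chebyshev requires;
each level is then the convex-set inequality. -/
theorem IsQuasiConcave.lintegral_min_one_sections_le {G : (ι → ℝ) × (κ → ℝ) → ℝ≥0∞}
    (hG : IsQuasiConcave G) :
    (((Fintype.card ι)! : ℕ) * ((Fintype.card κ)! : ℕ)) *
      ((∫⁻ y, min (G (y, 0)) 1) * ∫⁻ z, min (G (0, z)) 1)
      ≤ ((Fintype.card ι + Fintype.card κ)! : ℕ) * ∫⁻ x, min (G x) 1 := by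
  have a1 : AEMeasurable (fun y => G (y, 0)) :=
    (hG.comp preservesConvexCombos_mk_zero).aemeasurable volume
  have a2 : AEMeasurable (fun z => G (0, z)) :=
    (hG.comp preservesConvexCombos_zero_mk).aemeasurable volume
  rw [lintegral_min_one_eq_lintegral_meas_lt _ a1, lintegral_min_one_eq_lintegral_meas_lt _ a2,
    lintegral_min_one_eq_lintegral_meas_lt _ (hG.aemeasurable volume)]
  have : IsProbabilityMeasure (volume.restrict (Set.Ioo (0 : ℝ) 1)) := ⟨by simp⟩
  refine le_trans (mul_le_mul_right (lintegral_mul_lintegral_le_of_antitone ?_ ?_) _) ?_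
  · intro s t hst
    exact measure_mono fun x hx => lt_of_le_of_lt (ENNReal.ofReal_le_ofReal hst) hx
  · intro s t hst
    exact measure_mono fun x hx => lt_of_le_of_lt (ENNReal.ofReal_le_ofReal hst) hx
  · rw [← lintegral_const_mul' _ _
      (ENNReal.mul_ne_top (ENNReal.natCast_ne_top _) (ENNReal.natCast_ne_top _)),
      ← lintegral_const_mul' _ _ (ENNReal.natCast_ne_top _)]
    refine lintegral_mono fun t => ?_
    rw [mul_mul_mul_comm]
    exact (hG.convex_lt (ENNReal.ofReal t)).factorial_mul_volume_sections_le

theorem IsQuasiConcave.lintegral_sections_le {G : (ι → ℝ) × (κ → ℝ) → ℝ≥0∞}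
    (hG : IsQuasiConcave G) {M : ℝ≥0∞} (hM : ∀ x, G x ≤ M) :
    (((Fintype.card ι)! : ℕ) * ((Fintype.card κ)! : ℕ)) *
      ((∫⁻ y, G (y, 0)) * ∫⁻ z, G (0, z))
      ≤ ((Fintype.card ι + Fintype.card κ)! : ℕ) * (M * ∫⁻ x, G x) := by
  have a1 : AEMeasurable (fun y => G (y, 0)) :=
    (hG.comp preservesConvexCombos_mk_zero).aemeasurable volume
  have a2 : AEMeasurable (fun z => G (0, z)) :=
    (hG.comp preservesConvexCombos_zero_mk).aemeasurable volume
  have a3 := hG.aemeasurable volume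
  have hfac : ∀ n : ℕ, ((n ! : ℕ) : ℝ≥0∞) ≠ 0 := fun n => by
    exact_mod_cast n.factorial_ne_zero
  rcases eq_or_ne M 0 with rfl | hM0
  · have : ∀ x, G x = 0 := fun x => le_antisymm (hM x) zero_le
    simp [this]
  -- For `M = ∞` only `∫ G = 0` needs an argument: the truncated inequality forces one of the two
  -- section integrals to vanish.
  rcases eq_or_ne M ∞ with rfl | hMt
  · by_cases h0 : ∫⁻ x, G x = 0
    · have h1 := hG.lintegral_min_one_sections_le
      have h2 : ∫⁻ x, min (G x) 1 = 0 :=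
        le_antisymm (h0 ▸ lintegral_mono fun x => min_le_left _ _) zero_le
      rw [h2, mul_zero, nonpos_iff_eq_zero, mul_eq_zero, mul_eq_zero, mul_eq_zero] at h1
      rcases h1 with (h1 | h1) | (h1 | h1)
      · exact absurd h1 (hfac _)
      · exact absurd h1 (hfac _)
      · simp [lintegral_eq_zero_of_lintegral_min_one_eq_zero a1 h1]
      · simp [lintegral_eq_zero_of_lintegral_min_one_eq_zero a2 h1]
    · rw [ENNReal.top_mul h0, ENNReal.mul_top (hfac _)]
      exact le_top
  · have hq : IsQuasiConcave fun x => M⁻¹ * G x := by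
      intro x y a b ha hb hab
      rw [← mul_min]
      exact mul_le_mul_right (hG x y a b ha hb hab) _
    have hle : ∀ x, min (M⁻¹ * G x) 1 = M⁻¹ * G x := fun x => by
      apply min_eq_left
      rw [← ENNReal.inv_mul_cancel hM0 hMt]
      exact mul_le_mul_right (hM x) _
    have h1 := hq.lintegral_min_one_sections_le
    simp_rw [hle] at h1
    rw [lintegral_const_mul'' _ a1, lintegral_const_mul'' _ a2, lintegral_const_mul'' _ a3] at h1
    -- The left side is quadratic in `G` and the right side linear, so undoing the normalisation
    -- leaves one factor `M`.
    have h2 := mul_le_mul_right h1 (M * M)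
    have hc : M * M⁻¹ = 1 := ENNReal.mul_inv_cancel hM0 hMt
    calc _ = (M * M⁻¹) * (M * M⁻¹) * ((((Fintype.card ι)! : ℕ) * ((Fintype.card κ)! : ℕ)) *
          ((∫⁻ y, G (y, 0)) * ∫⁻ z, G (0, z))) := by rw [hc, one_mul, one_mul]
      _ = _ := by ring
      _ ≤ _ := h2
      _ = (M * M⁻¹) * (((Fintype.card ι + Fintype.card κ)! : ℕ) * (M * ∫⁻ x, G x)) := by ring
      _ = _ := by rw [hc, one_mul]

end Blocks

/-! ### Partitions into several blocks -/

section MultiBlock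

variable {ι : Type*} [DecidableEq ι]

theorem IsQuasiConcave.lmarginal_mul_lmarginal_le {f : (ι → ℝ) → ℝ≥0∞} (hf : IsQuasiConcave f)
    {M : ℝ≥0∞} (hM : ∀ x, f x ≤ M) {s t : Finset ι} (hst : Disjoint s t) :
    ((s.card ! : ℕ) * (t.card ! : ℕ)) *
      (lmarginal (fun _ => volume) s f 0 * lmarginal (fun _ => volume) t f 0)
      ≤ ((s.card + t.card)! : ℕ) * (M * lmarginal (fun _ => volume) (s ∪ t) f 0) := by
  have h := (hf.comp (preservesConvexCombos_updateFinset_updateFinset 0 s t)).lintegral_sections_le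
    (fun x => hM _)
  rw [lmarginal_union_eq_lintegral_prod f hst]
  have e1 : ∀ y : s → ℝ, Function.updateFinset (Function.updateFinset (0 : ι → ℝ) s y) t
      (0 : t → ℝ) = Function.updateFinset (0 : ι → ℝ) s y := by
    intro y
    ext j
    by_cases hj : j ∈ t
    · simp [Function.updateFinset, hj, Finset.disjoint_right.1 hst hj]
    · simp [Function.updateFinset, hj]
  have e2 : Function.updateFinset (0 : ι → ℝ) s (0 : s → ℝ) = 0 := by
    ext j
    simp [Function.updateFinset]
  simp only [Function.comp, e1, e2, Fintype.card_coe] at h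
  exact h

/-- Each piece beyond the first is merged by the two-section inequality, costing one factor `M`; the
intermediate factorial of the union cancels by being carried along on both sides. -/
theorem IsQuasiConcave.prod_lmarginal_le {f : (ι → ℝ) → ℝ≥0∞} (hf : IsQuasiConcave f)
    {M : ℝ≥0∞} (hM : ∀ x, f x ≤ M) {α : Type*} {J : Finset α} (hJ : J.Nonempty)
    (τ : α → Finset ι) (hτ : (J : Set α).PairwiseDisjoint τ) :
    (∏ j ∈ J, (((τ j).card ! : ℕ) : ℝ≥0∞)) * ∏ j ∈ J, lmarginal (fun _ => volume) (τ j) f 0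
      ≤ ((J.biUnion τ).card ! : ℕ) *
        (M ^ (J.card - 1) * lmarginal (fun _ => volume) (J.biUnion τ) f 0) := by
  classical
  induction hJ using Finset.Nonempty.cons_induction with
  | singleton a => simp
  | cons a J ha hJ ih =>
    have hd : Disjoint (τ a) (J.biUnion τ) := by
      rw [Finset.disjoint_biUnion_right]
      intro j hj
      exact hτ (by simp) (by simp [hj]) (by rintro rfl; exact ha hj)
    have ih' := ih (hτ.subset (by simp))
    have h2 := hf.lmarginal_mul_lmarginal_le hM hd
    rw [Finset.cons_eq_insert, Finset.prod_insert ha, Finset.prod_insert ha, Finset.biUnion_insert,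
      Finset.card_union_of_disjoint hd, Finset.card_insert_of_notMem ha, Nat.add_sub_cancel]
    have hk : J.card = (J.card - 1) + 1 := (Nat.sub_add_cancel hJ.card_pos).symm
    set Ia := MeasureTheory.lmarginal (fun _ => volume) (τ a) f 0
    set IJ := MeasureTheory.lmarginal (fun _ => volume) (J.biUnion τ) f 0
    set D : ℝ≥0∞ := (((J.biUnion τ).card ! : ℕ) : ℝ≥0∞)
    calc _ = ((((τ a).card ! : ℕ) : ℝ≥0∞) * Ia) *
          ((∏ j ∈ J, (((τ j).card ! : ℕ) : ℝ≥0∞)) *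
            ∏ j ∈ J, MeasureTheory.lmarginal (fun _ => volume) (τ j) f 0) := by ring
      _ ≤ ((((τ a).card ! : ℕ) : ℝ≥0∞) * Ia) * (D * (M ^ (J.card - 1) * IJ)) := by gcongr
      _ = M ^ (J.card - 1) * ((((τ a).card ! : ℕ) * D) * (Ia * IJ)) := by ring
      _ ≤ M ^ (J.card - 1) * _ := mul_le_mul_right h2 _
      _ = (((τ a).card + (J.biUnion τ).card)! : ℕ) * (M ^ (J.card - 1 + 1) *
          MeasureTheory.lmarginal (fun _ => volume) (τ a ∪ J.biUnion τ) f 0) := by ring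
      _ = _ := by rw [← hk]

end MultiBlock

/-! ### Integrals over coordinate subspaces as marginals -/

section CoordinateSubspaces

variable {n : ℕ}

theorem mem_orthogonal_coordSubspace {τ : Finset (Fin n)} {v : EuclideanSpace ℝ (Fin n)} :
    v ∈ (coordSubspace τ)ᗮ ↔ ∀ i ∈ τ, v i = 0 := by
  rw [coordSubspace, Submodule.mem_orthogonal]
  constructor
  · intro h i hi
    have := h (EuclideanSpace.single i 1) (Submodule.subset_span ⟨i, hi, rfl⟩)
    simpa [EuclideanSpace.inner_single_left] using this
  · intro h u hu
    induction hu using Submodule.span_induction with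
    | mem x hx =>
      obtain ⟨i, hi, rfl⟩ := hx
      simpa [EuclideanSpace.inner_single_left] using h i hi
    | zero => simp
    | add x y _ _ hx hy => rw [inner_add_left, hx, hy, add_zero]
    | smul a x _ hx => rw [inner_smul_left, hx, mul_zero]

/-- The orthogonal complement of `H_τ` is isometric to the space of coordinates outside `τ`. -/
noncomputable def orthogonalCoordSubspaceEquiv (τ : Finset (Fin n)) :
    EuclideanSpace ℝ (τᶜ : Finset (Fin n)) ≃ₗᵢ[ℝ] (coordSubspace τ)ᗮ where
  toFun y := ⟨WithLp.toLp 2 (Function.updateFinset 0 τᶜ y), by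
    rw [mem_orthogonal_coordSubspace]
    intro i hi
    simp [Function.updateFinset, hi]⟩
  invFun v := WithLp.toLp 2 fun i => (v : EuclideanSpace ℝ (Fin n)) i
  left_inv y := by
    ext i
    simp [Function.updateFinset]
  right_inv v := by
    ext i
    by_cases hi : i ∈ τ
    · simp [Function.updateFinset, hi, mem_orthogonal_coordSubspace.1 v.2 i hi]
    · simp [Function.updateFinset, hi]
  map_add' y z := by
    ext i
    by_cases hi : i ∈ τ <;> simp [Function.updateFinset, hi]
  map_smul' a y := by
    ext i
    by_cases hi : i ∈ τ <;> simp [Function.updateFinset, hi]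
  norm_map' y := by
    change ‖WithLp.toLp 2 (Function.updateFinset (0 : Fin n → ℝ) τᶜ y)‖ = ‖y‖
    rw [EuclideanSpace.norm_eq, EuclideanSpace.norm_eq,
      ← Finset.sum_subset (Finset.subset_univ τᶜ), ← Finset.sum_coe_sort]
    · congr 1
      refine Finset.sum_congr rfl fun i _ => ?_
      simp [Function.updateFinset]
    · intro i _ hi
      have : i ∈ τ := by simpa using hi
      simp [Function.updateFinset, this]

/-- Since `x` vanishes off `τ`, adding a vector of the complement amounts to overwriting the
coordinates outside `τ`. -/
theorem affineIntegral_orthogonal_coordSubspace (f : EuclideanSpace ℝ (Fin n) → ℝ)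
    (τ : Finset (Fin n)) (x : Fin n → ℝ) (hx : ∀ i ∉ τ, x i = 0) :
    affineIntegral f (coordSubspace τ)ᗮ (WithLp.toLp 2 x)
      = lmarginal (fun _ => volume) τᶜ (fun z => ENNReal.ofReal (f (WithLp.toLp 2 z))) x := by
  let e := orthogonalCoordSubspaceEquiv τ
  rw [affineIntegral, ← e.measurePreserving.lintegral_comp_emb e.toHomeomorph.measurableEmbedding,
    ← (PiLp.volume_preserving_toLp _).lintegral_comp_emb
      (MeasurableEquiv.toLp 2 _).measurableEmbedding]
  refine lintegral_congr fun y => ?_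
  congr 2
  ext i
  by_cases hi : i ∈ τ
  · simp [e, orthogonalCoordSubspaceEquiv, Function.updateFinset, hi]
  · simp [e, orthogonalCoordSubspaceEquiv, Function.updateFinset, hi, hx i hi]

theorem IsIntegrableLogConcave.isLogConcave_ofReal {f : EuclideanSpace ℝ (Fin n) → ℝ}
    (hf : IsIntegrableLogConcave f) :
    IsLogConcave fun z : Fin n → ℝ => ENNReal.ofReal (f (WithLp.toLp 2 z)) := by
  intro x y a b ha hb hab
  dsimp only
  rw [ENNReal.ofReal_rpow_of_nonneg (hf.nonneg _) ha.le,
    ENNReal.ofReal_rpow_of_nonneg (hf.nonneg _) hb.le,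
    ← ENNReal.ofReal_mul (Real.rpow_nonneg (hf.nonneg _) _)]
  apply ENNReal.ofReal_le_ofReal
  obtain rfl : a = 1 - b := by linarith
  have := hf.logConcave (WithLp.toLp 2 x) (WithLp.toLp 2 y) b ⟨hb.le, by linarith⟩
  simpa using this

theorem lintegral_ofReal_eq_lmarginal_univ (f : EuclideanSpace ℝ (Fin n) → ℝ) :
    ∫⁻ x, ENNReal.ofReal (f x) = lmarginal (fun _ => volume) Finset.univ
      (fun z => ENNReal.ofReal (f (WithLp.toLp 2 z))) 0 := by
  rw [lmarginal_univ, ← (PiLp.volume_preserving_toLp _).lintegral_comp_emb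
      (MeasurableEquiv.toLp 2 _).measurableEmbedding]
  rfl

end CoordinateSubspaces

/-! ### Assembly over the blocks of the cover -/

theorem mainTheorem3 (n m s : ℕ) (hs : s ≤ m)
    (f : EuclideanSpace ℝ (Fin n) → ℝ) (hf : IsIntegrableLogConcave f)
    (σ : Finset (Fin n)) (c : Fin m → Finset (Fin n)) (hc : ∀ j, c j ⊆ σ)
    (hred : IsOneReducibleCover (m - s) σ (fun j => σ \ c j)) :
    (⨆ x : EuclideanSpace ℝ (Fin n), affineIntegral f (coordSubspace σ)ᗮ x) ^ s
        * (∫⁻ x, ENNReal.ofReal (f x)) ^ (m - s)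
      ≥ (∏ j, (((σ.card - (c j).card)! : ℕ) : ℝ≥0∞)) / ((σ.card ! : ℕ) : ℝ≥0∞) ^ (m - s)
        * ∏ j, affineIntegral f (coordSubspace (c j))ᗮ 0 := by
  set g : (Fin n → ℝ) → ℝ≥0∞ := fun z => ENNReal.ofReal (f (WithLp.toLp 2 z)) with hg
  have hgl : IsLogConcave g := hf.isLogConcave_ofReal
  set F := lmarginal (fun _ => volume) σᶜ g with hF
  have hFq : IsQuasiConcave F := (hgl.lmarginal σᶜ).isQuasiConcave
  set S := ⨆ x : EuclideanSpace ℝ (Fin n), affineIntegral f (coordSubspace σ)ᗮ x with hS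
  set T := ∫⁻ x, ENNReal.ofReal (f x) with hT
  have hFS : ∀ x, F x ≤ S := by
    intro x
    -- `F` ignores the coordinates outside `σ`, so they may be set to zero.
    set x' : Fin n → ℝ := fun i => if i ∈ σ then x i else 0 with hx'
    have h1 : F x = F x' := lmarginal_congr _ _ fun i hi => by
      have : i ∈ σ := by simpa using hi
      simp [x', this]
    rw [h1, hF, ← affineIntegral_orthogonal_coordSubspace f σ x' fun i hi => by simp [x', hi]]
    exact le_iSup (fun x => affineIntegral f (coordSubspace σ)ᗮ x) _
  have hTF : T = lmarginal (fun _ => volume) σ F 0 := by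
    rw [hT, lintegral_ofReal_eq_lmarginal_univ, hF,
      ← hgl.isQuasiConcave.lmarginal_union disjoint_compl_right, Finset.union_compl]
  have hI : ∀ j, affineIntegral f (coordSubspace (c j))ᗮ 0
      = lmarginal (fun _ => volume) (σ \ c j) F 0 := by
    intro j
    have hd : Disjoint (σ \ c j) σᶜ := disjoint_compl_right.mono_left Finset.sdiff_subset
    rw [hF, ← hgl.isQuasiConcave.lmarginal_union hd]
    have : σ \ c j ∪ σᶜ = (c j)ᶜ := by
      ext i
      have := @hc j i
      simp only [Finset.mem_union, Finset.mem_sdiff, Finset.mem_compl]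
      tauto
    rw [this]
    exact affineIntegral_orthogonal_coordSubspace f (c j) 0 fun _ _ => rfl
  have hcard : ∀ j, σ.card - (c j).card = (σ \ c j).card := fun j =>
    (Finset.card_sdiff_of_subset (hc j)).symm
  simp_rw [hI, hcard]
  obtain ⟨-, b, hb⟩ := hred
  -- For empty `σ` a block may have no members, so this case is separate; there `T = F 0 ≤ S`
  -- suffices. Otherwise a point of `σ` makes every block nonempty.
  rcases σ.eq_empty_or_nonempty with rfl | ⟨i₀, hi₀⟩
  · have hTS : T ≤ S := by
      rw [hTF, lmarginal_empty]
      exact hFS 0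
    simp only [Finset.empty_sdiff, Finset.card_empty, Nat.factorial_zero, Nat.cast_one,
      Finset.prod_const_one, one_pow, div_one, one_mul, Finset.prod_const, Finset.card_univ,
      Fintype.card_fin, ← hTF]
    calc T ^ m = T ^ s * T ^ (m - s) := by rw [← pow_add, Nat.add_sub_cancel' hs]
      _ ≤ S ^ s * T ^ (m - s) := by gcongr
  have hblock : ∀ k : Fin (m - s), (∏ j with b j = k, (((σ \ c j).card ! : ℕ) : ℝ≥0∞)) *
      ∏ j with b j = k, lmarginal (fun _ => volume) (σ \ c j) F 0
      ≤ (σ.card ! : ℕ) * (S ^ ((Finset.univ.filter fun j => b j = k).card - 1) * T)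
      ∧ 1 ≤ (Finset.univ.filter fun j => b j = k).card := by
    intro k
    have huniq : ∀ i ∈ σ, ∃ j, (b j = k ∧ i ∈ σ \ c j) ∧
        ∀ j', b j' = k → i ∈ σ \ c j' → j' = j := by
      intro i hi
      obtain ⟨⟨j, hj⟩, hj'⟩ := Finset.card_eq_one.1 ((hb k).2 i hi)
      refine ⟨j, ⟨hj, ?_⟩, ?_⟩
      · have : (⟨j, hj⟩ : {i // b i = k}) ∈ ({⟨j, hj⟩} : Finset {i // b i = k}) := by simp
        rw [← hj'] at this
        exact (Finset.mem_filter.1 this).2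
      · intro l hl hil
        have : (⟨l, hl⟩ : {i // b i = k}) ∈ ({⟨j, hj⟩} : Finset {i // b i = k}) := by
          rw [← hj']
          exact Finset.mem_filter.2 ⟨Finset.mem_univ _, hil⟩
        simpa using this
    have hne : (Finset.univ.filter fun j => b j = k).Nonempty := by
      obtain ⟨j, ⟨hj, -⟩, -⟩ := huniq i₀ hi₀
      exact ⟨j, by simp [hj]⟩
    have hun : (Finset.univ.filter fun j => b j = k).biUnion (fun j => σ \ c j) = σ := by
      ext i
      simp only [Finset.mem_biUnion, Finset.mem_filter, Finset.mem_univ, true_and]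
      constructor
      · rintro ⟨j, -, hj⟩
        exact (Finset.mem_sdiff.1 hj).1
      · intro hi
        obtain ⟨j, ⟨hj, hij⟩, -⟩ := huniq i hi
        exact ⟨j, hj, hij⟩
    refine ⟨?_, hne.card_pos⟩
    have := hFq.prod_lmarginal_le hFS hne (fun j => σ \ c j) ?_
    · rwa [hun, ← hTF] at this
    · intro j hj l hl hjl
      rw [Function.onFun, Finset.disjoint_left]
      intro i hi hi'
      obtain ⟨j₀, -, h0⟩ := huniq i (Finset.mem_sdiff.1 hi).1
      exact hjl ((h0 j (by simpa using hj) hi).trans (h0 l (by simpa using hl) hi').symm)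
  -- The `m - s` nonempty blocks have `m` members in all, so the total exponent of `S` is `m - (m -
  -- s) = s`.
  have hsum : ∑ k : Fin (m - s), ((Finset.univ.filter fun j => b j = k).card - 1) = s := by
    have h1 : ∑ k : Fin (m - s), (Finset.univ.filter fun j => b j = k).card = m := by
      rw [← Finset.card_eq_sum_card_fiberwise (fun _ _ => Finset.mem_coe.2 (Finset.mem_univ _))]
      simp
    have h2 : ∑ k : Fin (m - s), ((Finset.univ.filter fun j => b j = k).card - 1) + (m - s) = m := by
      have h3 : ∑ k : Fin (m - s), ((Finset.univ.filter fun j => b j = k).card - 1)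
          + ∑ _k : Fin (m - s), 1 = m := by
        rw [← Finset.sum_add_distrib]
        exact (Finset.sum_congr rfl fun k _ => Nat.sub_add_cancel (hblock k).2).trans h1
      simpa using h3
    omega
  have hprod := Finset.prod_le_prod' fun k (_ : k ∈ Finset.univ) => (hblock k).1
  rw [Finset.prod_mul_distrib, Finset.prod_fiberwise, Finset.prod_fiberwise,
    Finset.prod_mul_distrib, Finset.prod_mul_distrib, Finset.prod_pow_eq_pow_sum, hsum] at hprod
  simp only [Finset.prod_const, Finset.card_univ, Fintype.card_fin] at hprod
  rw [ge_iff_le, div_eq_mul_inv, mul_right_comm, ← div_eq_mul_inv]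
  exact ENNReal.div_le_of_le_mul' hprod
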